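/- A binary linear code of length $n$ is a linear subspace $C\subseteq\mathbb F_2^n$; it is an $[n,k,d]$ code if it has dimension $k$ and minimum Hamming distance $d$. An information set of $C$ is a set $I$ of coordinates such that every tuple in $\mathbb F_2^I$ occurs in exactly one codeword within the coordinates in $I$. A $3$-CIS code is a binary linear code of length $3k$ and dimension $k$ that has three pairwise disjoint information sets. A binary linear code is optimal if its minimum distance is the largest possible among all binary linear codes of the same length and dimension. Two binary linear codes of length $n$ are equivalent if one is obtained from the other by a permutation of the $n$ coordinates. Theorem. For each length $3k\in\{3,6,12,15\}$ there is, up to equivalence, exactly one optimal $3$-CIS code of length $3k$. Up to equivalence, there are exactly eight optimal $3$-CIS $[9,3,4]$ codes. -/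

import Mathlib

/-- Binary linear codes of length `n`. -/
abbrev BinaryCode (n : ℕ) : Type := Submodule (ZMod 2) (Fin n → ZMod 2)

namespace BinaryCode

/-- The dimension of a binary linear code. -/
noncomputable def dim {n : ℕ} (C : BinaryCode n) : ℕ := Module.finrank (ZMod 2) C

/-- `C` has minimum (Hamming) distance `d`. In particular `C` has at least two codewords. -/
def HasMinDist {n : ℕ} (C : BinaryCode n) (d : ℕ) : Prop :=
  IsLeast {m : ℕ | ∃ x ∈ C, ∃ y ∈ C, x ≠ y ∧ hammingDist x y = m} d

/-- `C` is an `[n, k, d]` code. -/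
def HasParameters {n : ℕ} (C : BinaryCode n) (k d : ℕ) : Prop :=
  C.dim = k ∧ C.HasMinDist d

/-- `I` is an information set of `C`: every tuple indexed by `I` occurs in exactly one codeword
within the coordinates in `I`. -/
def IsInformationSet {n : ℕ} (C : BinaryCode n) (I : Finset (Fin n)) : Prop :=
  ∀ v : I → ZMod 2, ∃! c : Fin n → ZMod 2, c ∈ C ∧ ∀ i : I, c i = v i

/-- `C` is a `t`-CIS code: it is a `[tk, k]` code with `t` pairwise disjoint information sets. -/
def IsCIS {n : ℕ} (t : ℕ) (C : BinaryCode n) : Prop :=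
  n = t * C.dim ∧
    ∃ I : Fin t → Finset (Fin n),
      (∀ i j : Fin t, i ≠ j → Disjoint (I i) (I j)) ∧ ∀ i : Fin t, C.IsInformationSet (I i)

/-- `C` is optimal: its minimum distance is the largest among all binary linear codes of the same
length and dimension. -/
def IsOptimal {n : ℕ} (C : BinaryCode n) : Prop :=
  ∃ d : ℕ, C.HasMinDist d ∧
    ∀ C' : BinaryCode n, C'.dim = C.dim → ∀ d' : ℕ, C'.HasMinDist d' → d' ≤ d

/-- Two codes are equivalent if one is obtained from the other by a permutation of the
coordinates. -/
def Equivalent {n : ℕ} (C C' : BinaryCode n) : Prop :=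
  ∃ σ : Equiv.Perm (Fin n), ∀ x : Fin n → ZMod 2, x ∈ C' ↔ (fun i => x (σ i)) ∈ C

theorem equivalent_equivalence (n : ℕ) :
    Equivalence (Equivalent : BinaryCode n → BinaryCode n → Prop) where
  refl C := ⟨1, fun _ => Iff.rfl⟩
  symm := by
    rintro C C' ⟨σ, h⟩
    refine ⟨σ⁻¹, fun x => ?_⟩
    rw [h]
    simp
  trans := by
    rintro C C' C'' ⟨σ, h⟩ ⟨τ, h'⟩
    refine ⟨τ * σ, fun x => ?_⟩
    rw [h', h]
    rfl

/-- Equivalence of codes of length `n`, as a setoid. -/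
def equivSetoid (n : ℕ) : Setoid (BinaryCode n) := ⟨Equivalent, equivalent_equivalence n⟩

/-- The number of equivalence classes of codes that meet the set `S`. -/
noncomputable def numClasses {n : ℕ} (S : Set (BinaryCode n)) : ℕ :=
  (Quotient.mk (equivSetoid n) '' S).ncard

end BinaryCode

/-! A code of dimension k is given by the n columns of a generator matrix, so up to equivalence it
is a multiset of points of F_2^k modulo GL_k; the weight of the message v is the number of columns
not orthogonal to v. Disjoint information sets of a CIS code exhaust the coordinates, so no column
is zero. Summing weights over all messages (`sum_weight`) and over a hyperplane of messages
(`sum_weight_hyperplane`) bounds the distance (`plotkin_bound`) and the multiplicity of each column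
(`multiplicity_bound`).

In lengths 3, 6, 12, 15 the optimal distances 3, 4, 6, 7 force the multiset up to GL_k: the nonzero
point of F_2 three times; each nonzero point of F_2^2 twice; the complement of a plane through 0 in
F_2^4; an affine hyperplane of F_2^5 avoiding 0, minus one point. In length 9 all multiplicities are
at most 3. Maximising them lexicographically over GL_3 leaves eight cases, which are separated by
the number of words of weight 4 and the number of unrepeated columns. -/

namespace BinaryCode

open Finset Matrix

/-! ### Codes as systems of columns -/

/-- The code whose generator matrix has the columns `c i`. -/
noncomputable def ofColumns {n k : ℕ} (c : Fin n → Fin k → ZMod 2) : BinaryCode n :=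
  LinearMap.range (Matrix.mulVecLin (Matrix.of c))

/-- The weight of the codeword with message `v` in the code with columns `c`. -/
def weight {n k : ℕ} (c : Fin n → Fin k → ZMod 2) (v : Fin k → ZMod 2) : ℕ :=
  #{i | c i ⬝ᵥ v ≠ 0}

/-- The number of times that `p` occurs among the columns `c`. -/
def multiplicity {n k : ℕ} (c : Fin n → Fin k → ZMod 2) (p : Fin k → ZMod 2) : ℕ :=
  #{i | c i = p}

theorem mem_ofColumns {n k : ℕ} {c : Fin n → Fin k → ZMod 2} {x : Fin n → ZMod 2} :
    x ∈ ofColumns c ↔ ∃ v, ∀ i, c i ⬝ᵥ v = x i := by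
  simp only [ofColumns, LinearMap.mem_range, funext_iff]
  rfl

theorem hammingNorm_eq_weight {n k : ℕ} (c : Fin n → Fin k → ZMod 2) (v : Fin k → ZMod 2) :
    hammingNorm (fun i => c i ⬝ᵥ v) = weight c v := rfl

theorem weight_zero {n k : ℕ} (c : Fin n → Fin k → ZMod 2) : weight c 0 = 0 := by
  simp [weight]

/-- The columns span, that is, distinct messages have distinct codewords. -/
def Spanning {n k : ℕ} (c : Fin n → Fin k → ZMod 2) : Prop :=
  ∀ v, (∀ i, c i ⬝ᵥ v = 0) → v = 0

theorem Spanning.injective {n k : ℕ} {c : Fin n → Fin k → ZMod 2} (h : Spanning c) :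
    Function.Injective (Matrix.mulVecLin (Matrix.of c)) := by
  rw [← LinearMap.ker_eq_bot, LinearMap.ker_eq_bot']
  exact fun v hv => h v fun i => congrFun hv i

theorem Spanning.dim_eq {n k : ℕ} {c : Fin n → Fin k → ZMod 2} (h : Spanning c) :
    (ofColumns c).dim = k := by
  rw [dim, ofColumns, LinearMap.finrank_range_of_inj h.injective]
  simp

theorem exists_columns {n k : ℕ} (C : BinaryCode n) (hC : C.dim = k) :
    ∃ c : Fin n → Fin k → ZMod 2, Spanning c ∧ ofColumns c = C := by
  let b := Module.finBasisOfFinrankEq (ZMod 2) C hC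
  have key : ∀ v : Fin k → ZMod 2, ∀ i,
      (fun j => (b j : Fin n → ZMod 2) i) ⬝ᵥ v = (b.equivFun.symm v : Fin n → ZMod 2) i := by
    intro v i
    rw [Module.Basis.equivFun_symm_apply]
    simp [dotProduct, mul_comm]
  refine ⟨fun i j => (b j : Fin n → ZMod 2) i, fun v hv => ?_, ?_⟩
  · have : b.equivFun.symm v = 0 := by
      ext i
      rw [← key, hv i]
      rfl
    exact (LinearEquiv.map_eq_zero_iff _).1 this
  · ext x
    rw [mem_ofColumns]
    constructor
    · rintro ⟨v, hv⟩
      have : x = (b.equivFun.symm v : Fin n → ZMod 2) := by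
        ext i
        rw [← hv, key]
      rw [this]
      exact Subtype.property _
    · intro hx
      refine ⟨b.equivFun ⟨x, hx⟩, fun i => ?_⟩
      rw [key]
      simp

theorem hasMinDist_ofColumns {n k : ℕ} {c : Fin n → Fin k → ZMod 2} (h : Spanning c) {d : ℕ} :
    (ofColumns c).HasMinDist d ↔ (∀ v, v ≠ 0 → d ≤ weight c v) ∧ ∃ v, v ≠ 0 ∧ weight c v = d := by
  have hset : {m : ℕ | ∃ x ∈ ofColumns c, ∃ y ∈ ofColumns c, x ≠ y ∧ hammingDist x y = m} =
      {m | ∃ v, v ≠ 0 ∧ weight c v = m} := by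
    ext m
    constructor
    · rintro ⟨x, ⟨v, rfl⟩, y, ⟨w, rfl⟩, hxy, rfl⟩
      refine ⟨v - w, fun h0 => hxy (by rw [sub_eq_zero.1 h0]), ?_⟩
      rw [hammingDist_eq_hammingNorm, neg_add_eq_sub, ← map_sub, ← hammingNorm_eq_weight]
      rw [← neg_sub v w, map_neg]
      simp only [hammingNorm, Pi.neg_apply, neg_ne_zero]
      rfl
    · rintro ⟨v, hv, rfl⟩
      refine ⟨_, ⟨v, rfl⟩, 0, Submodule.zero_mem _, ?_, ?_⟩
      · exact fun h0 => hv (h.injective (by rw [h0, map_zero]))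
      · rw [hammingDist_zero_right]
        rfl
  rw [HasMinDist, hset]
  constructor
  · rintro ⟨h1, h2⟩
    exact ⟨fun v hv => h2 ⟨v, hv, rfl⟩, h1⟩
  · rintro ⟨h1, h2⟩
    refine ⟨h2, ?_⟩
    rintro m ⟨v, hv, rfl⟩
    exact h1 v hv

/-- A linear map on columns acts on messages by its transpose, so it only relabels the codewords. -/
theorem ofColumns_linearEquiv {n k : ℕ} (c : Fin n → Fin k → ZMod 2)
    (A : (Fin k → ZMod 2) ≃ₗ[ZMod 2] (Fin k → ZMod 2)) :
    ofColumns (fun i => A (c i)) = ofColumns c := by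
  have key : ∀ (B : (Fin k → ZMod 2) →ₗ[ZMod 2] (Fin k → ZMod 2)) (v : Fin k → ZMod 2),
      ∃ w, ∀ x, B x ⬝ᵥ v = x ⬝ᵥ w := by
    intro B v
    refine ⟨(LinearMap.toMatrix' B)ᵀ *ᵥ v, fun x => ?_⟩
    rw [Matrix.mulVec_transpose, dotProduct_comm x, ← Matrix.dotProduct_mulVec,
      LinearMap.toMatrix'_mulVec, dotProduct_comm]
  ext x
  rw [mem_ofColumns, mem_ofColumns]
  constructor
  · rintro ⟨v, hv⟩
    obtain ⟨w, hw⟩ := key A v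
    exact ⟨w, fun i => by rw [← hw, ← hv]; rfl⟩
  · rintro ⟨v, hv⟩
    obtain ⟨w, hw⟩ := key A.symm v
    exact ⟨w, fun i => by rw [← hw, ← hv]; simp⟩

theorem exists_weight_linearEquiv {n k : ℕ} (c : Fin n → Fin k → ZMod 2)
    (A : (Fin k → ZMod 2) ≃ₗ[ZMod 2] (Fin k → ZMod 2)) {v : Fin k → ZMod 2} (hv : v ≠ 0) :
    ∃ w, w ≠ 0 ∧ weight (fun i => A (c i)) v = weight c w := by
  have key : ∀ x, A x ⬝ᵥ v = x ⬝ᵥ ((LinearMap.toMatrix' (A : _ →ₗ[ZMod 2] _))ᵀ *ᵥ v) := by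
    intro x
    rw [Matrix.mulVec_transpose, dotProduct_comm x, ← Matrix.dotProduct_mulVec,
      LinearMap.toMatrix'_mulVec, dotProduct_comm]
    rfl
  refine ⟨(LinearMap.toMatrix' (A : _ →ₗ[ZMod 2] _))ᵀ *ᵥ v, fun h0 => hv ?_, by
    simp only [weight, key]⟩
  refine dotProduct_eq_zero _ fun w => ?_
  rw [dotProduct_comm, ← A.apply_symm_apply w, key, h0, dotProduct_zero]

theorem equivalent_of_multiplicity_eq {n k : ℕ} {c c' : Fin n → Fin k → ZMod 2}
    (h : ∀ p, multiplicity c p = multiplicity c' p) : (ofColumns c).Equivalent (ofColumns c') := by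
  obtain ⟨σ, hσ⟩ : ∃ σ : Equiv.Perm (Fin n), ∀ i, c' (σ i) = c i := by
    have e : ∀ p, {i // c i = p} ≃ {i // c' i = p} := fun p => by
      refine Fintype.equivOfCardEq ?_
      rw [Fintype.card_subtype, Fintype.card_subtype]
      exact h p
    exact ⟨Equiv.ofFiberEquiv e, Equiv.ofFiberEquiv_map e⟩
  refine ⟨σ, fun x => ?_⟩
  simp only [mem_ofColumns, ← hσ]
  exact exists_congr fun v => (σ.forall_congr_right (q := fun i => c' i ⬝ᵥ v = x i)).symm

theorem numClasses_eq {n m : ℕ} {S : Set (BinaryCode n)} (f : Fin m → BinaryCode n)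
    (hf : ∀ j, f j ∈ S) (hS : ∀ C ∈ S, ∃ j, (f j).Equivalent C)
    (hinj : ∀ i j, (f i).Equivalent (f j) → i = j) : numClasses S = m := by
  have himage : Quotient.mk (equivSetoid n) '' S =
      (fun j => Quotient.mk (equivSetoid n) (f j)) '' Set.univ := by
    ext q
    constructor
    · rintro ⟨C, hC, rfl⟩
      obtain ⟨j, hj⟩ := hS C hC
      exact ⟨j, trivial, Quotient.sound hj⟩
    · rintro ⟨j, -, rfl⟩
      exact ⟨f j, hf j, rfl⟩
  rw [numClasses, himage, Set.ncard_image_of_injective, Set.ncard_univ, Nat.card_fin]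
  exact fun i j hij => hinj i j (Quotient.exact hij)

/-! ### Information sets -/

/-- `finProdFinEquiv` cuts the coordinates into consecutive blocks of length k; the explicit column
lists are ordered so that each block is a basis. -/
theorem isCIS_ofColumns {t k : ℕ} {c : Fin (t * k) → Fin k → ZMod 2} (hc : Spanning c)
    (h : ∀ i : Fin t, ∀ v, (∀ j, c (finProdFinEquiv (i, j)) ⬝ᵥ v = 0) → v = 0) :
    (ofColumns c).IsCIS t := by
  refine ⟨by rw [hc.dim_eq], fun i => univ.image fun j => finProdFinEquiv (i, j), ?_, ?_⟩
  · intro i i' hii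
    rw [Finset.disjoint_left]
    intro a ha ha'
    simp only [mem_image, mem_univ, true_and] at ha ha'
    obtain ⟨j, rfl⟩ := ha
    obtain ⟨j', hj⟩ := ha'
    exact hii (congrArg Prod.fst (finProdFinEquiv.injective hj)).symm
  · intro i v
    let L := Matrix.mulVecLin (Matrix.of fun j => c (finProdFinEquiv (i, j)))
    have hL : Function.Injective L := by
      rw [← LinearMap.ker_eq_bot, LinearMap.ker_eq_bot']
      exact fun v hv => h i v fun j => congrFun hv j
    obtain ⟨u, hu⟩ := (LinearMap.injective_iff_surjective.1 hL) fun j =>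
      v ⟨finProdFinEquiv (i, j), mem_image_of_mem _ (mem_univ j)⟩
    refine ⟨fun a => c a ⬝ᵥ u, ⟨mem_ofColumns.2 ⟨u, fun _ => rfl⟩, ?_⟩, ?_⟩
    · rintro ⟨a, ha⟩
      simp only [mem_image, mem_univ, true_and] at ha
      obtain ⟨j, rfl⟩ := ha
      exact congrFun hu j
    · rintro x ⟨hx, hxv⟩
      obtain ⟨w, hw⟩ := mem_ofColumns.1 hx
      have : w = u := hL <| by
        rw [hu]
        ext j
        rw [← hxv]
        exact hw _
      ext a
      rw [← hw, this]

theorem IsInformationSet.card_eq {n : ℕ} {C : BinaryCode n} {I : Finset (Fin n)}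
    (h : C.IsInformationSet I) : #I = C.dim := by
  let ρ : C →ₗ[ZMod 2] (I → ZMod 2) :=
    (LinearMap.funLeft (ZMod 2) (ZMod 2) (Subtype.val : I → Fin n)) ∘ₗ C.subtype
  have hρ : Function.Bijective ρ := by
    constructor
    · intro x y hxy
      obtain ⟨z, -, hz⟩ := h (ρ x)
      exact Subtype.ext ((hz x ⟨x.2, fun _ => rfl⟩).trans
        (hz y ⟨y.2, fun i => (congrFun hxy i).symm⟩).symm)
    · intro v
      obtain ⟨z, ⟨hz, hzv⟩, -⟩ := h v
      exact ⟨⟨z, hz⟩, funext hzv⟩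
  rw [dim, (LinearEquiv.ofBijective ρ hρ).finrank_eq]
  simp

/-- The t disjoint information sets have `dim` elements each, so they cover every coordinate, and a
codeword can be prescribed to be 1 there. -/
theorem IsCIS.exists_ne_zero {n t : ℕ} {C : BinaryCode n} (h : C.IsCIS t) (i : Fin n) :
    ∃ x ∈ C, x i ≠ 0 := by
  obtain ⟨hn, I, hd, hI⟩ := h
  have hcard : #(univ.biUnion I) = n := by
    rw [card_biUnion fun i _ j _ hij => hd i j hij, sum_congr rfl fun i _ => (hI i).card_eq]
    simpa using hn.symm
  have huniv : univ.biUnion I = univ := by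
    rw [← card_eq_iff_eq_univ, hcard, Fintype.card_fin]
  obtain ⟨j, -, hj⟩ := mem_biUnion.1 (huniv ▸ mem_univ i)
  obtain ⟨x, ⟨hx, hxv⟩, -⟩ := hI j fun _ => 1
  exact ⟨x, hx, by rw [hxv ⟨i, hj⟩]; exact one_ne_zero⟩

theorem IsCIS.column_ne_zero {n k t : ℕ} {c : Fin n → Fin k → ZMod 2}
    (h : (ofColumns c).IsCIS t) (i : Fin n) : c i ≠ 0 := by
  intro h0
  obtain ⟨x, hx, hxi⟩ := h.exists_ne_zero i
  obtain ⟨v, hv⟩ := mem_ofColumns.1 hx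
  exact hxi (by rw [← hv, h0, zero_dotProduct])

/-! ### Invariants of equivalence -/

theorem Equivalent.ncard_hammingNorm_eq {n : ℕ} {C C' : BinaryCode n} (h : C.Equivalent C')
    (w : ℕ) : {x | x ∈ C ∧ hammingNorm x = w}.ncard = {x | x ∈ C' ∧ hammingNorm x = w}.ncard := by
  obtain ⟨σ, hσ⟩ := h
  have hinj : Function.Injective fun (x : Fin n → ZMod 2) i => x (σ i) :=
    σ.surjective.injective_comp_right
  have hnorm : ∀ x : Fin n → ZMod 2, hammingNorm (fun i => x (σ i)) = hammingNorm x := fun x =>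
    card_equiv σ (by simp)
  rw [← Set.ncard_image_of_injective {x | x ∈ C' ∧ hammingNorm x = w} hinj]
  congr 1
  ext x
  constructor
  · rintro ⟨hx, hxw⟩
    have hx' : x = fun i => (fun i => x (σ.symm i)) (σ i) := by simp
    refine ⟨fun i => x (σ.symm i), ⟨?_, ?_⟩, hx'.symm⟩
    · rwa [hσ, ← hx']
    · rwa [← hnorm, ← hx']
  · rintro ⟨y, ⟨hy, hyw⟩, rfl⟩
    exact ⟨(hσ y).1 hy, by rw [hnorm, hyw]⟩

theorem Equivalent.ncard_unrepeated_eq {n : ℕ} {C C' : BinaryCode n} (h : C.Equivalent C') :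
    {i | ∀ j, (∀ x ∈ C, x j = x i) → j = i}.ncard =
      {i | ∀ j, (∀ x ∈ C', x j = x i) → j = i}.ncard := by
  obtain ⟨σ, hσ⟩ := h
  have key : ∀ i j, (∀ x ∈ C, x j = x i) ↔ ∀ x ∈ C', x (σ j) = x (σ i) := by
    intro i j
    constructor
    · exact fun H x hx => H _ ((hσ x).1 hx)
    · intro H x hx
      have := H (fun i => x (σ.symm i)) ((hσ _).2 (by simpa using hx))
      simpa using this
  rw [← Set.ncard_image_of_injective _ σ.injective]
  congr 1
  ext a
  obtain ⟨i, rfl⟩ := σ.surjective a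
  rw [σ.injective.mem_set_image]
  simp only [Set.mem_ofPred_eq, key]
  rw [σ.forall_congr_left]
  simp [Equiv.symm_apply_eq]

theorem Spanning.ncard_hammingNorm_eq {n k : ℕ} {c : Fin n → Fin k → ZMod 2} (h : Spanning c)
    (w : ℕ) : {x | x ∈ ofColumns c ∧ hammingNorm x = w}.ncard = #{v | weight c v = w} := by
  rw [← Set.ncard_coe_finset, ← Set.ncard_image_of_injective _ h.injective]
  congr 1
  ext x
  constructor
  · rintro ⟨⟨v, rfl⟩, hv⟩
    exact ⟨v, mem_coe.2 (mem_filter.2 ⟨mem_univ v, hv⟩), rfl⟩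
  · rintro ⟨v, hv, rfl⟩
    exact ⟨⟨v, rfl⟩, (mem_filter.1 (mem_coe.1 hv)).2⟩

theorem ncard_unrepeated_ofColumns {n k : ℕ} (c : Fin n → Fin k → ZMod 2) :
    {i | ∀ j, (∀ x ∈ ofColumns c, x j = x i) → j = i}.ncard =
      #{i | ∀ j, c j = c i → j = i} := by
  have key : ∀ i j, (∀ x ∈ ofColumns c, x j = x i) ↔ c j = c i := by
    intro i j
    constructor
    · intro H
      refine dotProduct_eq _ _ fun v => ?_
      exact H _ (mem_ofColumns.2 ⟨v, fun _ => rfl⟩)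
    · rintro H x hx
      obtain ⟨v, hv⟩ := mem_ofColumns.1 hx
      rw [← hv, ← hv, H]
  simp only [key]
  rw [← Set.ncard_coe_finset]
  simp

/-! ### Character sums and weight bounds -/

/-- The nontrivial character of the field with two elements. -/
def sign (a : ZMod 2) : ℤ := if a = 0 then 1 else -1

theorem sign_add : ∀ a b, sign (a + b) = sign a * sign b := by decide

/-- If p is nonzero, translation by some u not orthogonal to p negates the sum. -/
theorem sum_sign {k : ℕ} (p : Fin k → ZMod 2) :
    ∑ v : Fin k → ZMod 2, sign (p ⬝ᵥ v) = if p = 0 then 2 ^ k else 0 := by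
  split_ifs with hp
  · simp [hp, sign]
  · obtain ⟨u, hu⟩ : ∃ u, p ⬝ᵥ u ≠ 0 := by
      by_contra! H
      exact hp (dotProduct_eq_zero p H)
    have hu' : sign (p ⬝ᵥ u) = -1 := if_neg hu
    have h := Equiv.sum_comp (Equiv.addRight u) fun v => sign (p ⬝ᵥ v)
    simp only [Equiv.coe_addRight, dotProduct_add, sign_add, hu', ← sum_mul] at h
    linarith

theorem weight_eq_sum {n k : ℕ} (c : Fin n → Fin k → ZMod 2) (v : Fin k → ZMod 2) :
    2 * (weight c v : ℤ) = ∑ i, (1 - sign (c i ⬝ᵥ v)) := by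
  rw [weight, card_filter, Nat.cast_sum, mul_sum]
  refine sum_congr rfl fun i _ => ?_
  by_cases h : c i ⬝ᵥ v = 0 <;> simp [h, sign]

theorem multiplicity_eq_sum {n k : ℕ} (c : Fin n → Fin k → ZMod 2) (p : Fin k → ZMod 2) :
    (2 : ℤ) ^ k * multiplicity c p = ∑ i, if c i = p then 2 ^ k else 0 := by
  rw [multiplicity, card_filter, Nat.cast_sum, mul_sum]
  refine sum_congr rfl fun i _ => ?_
  split_ifs <;> simp

theorem sum_weight {n k : ℕ} (c : Fin n → Fin k → ZMod 2) :
    2 * ∑ v, weight c v + 2 ^ k * multiplicity c 0 = 2 ^ k * n := by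
  zify
  rw [mul_sum, multiplicity_eq_sum, sum_congr rfl fun v _ => weight_eq_sum c v, sum_comm,
    ← sum_add_distrib]
  simp only [sum_sub_distrib, sum_sign]
  simp [mul_comm]

theorem sum_weight_hyperplane {n k : ℕ} (c : Fin n → Fin k → ZMod 2) {p : Fin k → ZMod 2}
    (hp : p ≠ 0) :
    4 * ∑ v with p ⬝ᵥ v = 0, weight c v + 2 ^ k * (multiplicity c 0 + multiplicity c p) =
      2 ^ k * n := by
  -- Both indicators are halves of 1 ± a character. Their product expands into characters, of which
  -- only the trivial ones survive summation over v.
  have hterm : ∀ v : Fin k → ZMod 2, (4 * if p ⬝ᵥ v = 0 then (weight c v : ℤ) else 0) =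
      ∑ i, (1 + sign (p ⬝ᵥ v) - sign (c i ⬝ᵥ v) - sign ((c i + p) ⬝ᵥ v)) := by
    intro v
    have h : ∀ i, 1 + sign (p ⬝ᵥ v) - sign (c i ⬝ᵥ v) - sign ((c i + p) ⬝ᵥ v) =
        (1 + sign (p ⬝ᵥ v)) * (1 - sign (c i ⬝ᵥ v)) := by
      intro i
      rw [add_dotProduct, sign_add]
      ring
    simp only [h, ← mul_sum, ← weight_eq_sum]
    by_cases hv : p ⬝ᵥ v = 0
    · simp [hv, sign]; ring
    · simp [hv, sign]
  have hsum : ∀ i, c i + p = 0 ↔ c i = p := by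
    intro i
    rw [add_eq_zero_iff_eq_neg, ZModModule.neg_eq_self]
  zify
  rw [sum_filter, mul_sum, mul_add, multiplicity_eq_sum, multiplicity_eq_sum,
    sum_congr rfl fun v _ => hterm v, sum_comm, ← sum_add_distrib, ← sum_add_distrib]
  simp only [sum_sub_distrib, sum_add_distrib, sum_sign, hp, hsum]
  simp [mul_comm]

theorem card_hyperplane {k : ℕ} {p : Fin k → ZMod 2} (hp : p ≠ 0) :
    2 * #{v | p ⬝ᵥ v = 0} = 2 ^ k := by
  have h := sum_sign p
  have hterm : ∀ v, sign (p ⬝ᵥ v) = 2 * (if p ⬝ᵥ v = 0 then 1 else 0) - 1 := by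
    intro v
    by_cases hv : p ⬝ᵥ v = 0 <;> simp [hv, sign]
  rw [if_neg hp, sum_congr rfl fun v _ => hterm v, sum_sub_distrib, ← mul_sum] at h
  rw [card_filter]
  zify
  simp only [sum_const, card_univ, Fintype.card_pi, ZMod.card, prod_const, Fintype.card_fin,
    nsmul_eq_mul] at h
  push_cast at h
  linarith

/-- The Plotkin bound. -/
theorem plotkin_bound {n k d : ℕ} {c : Fin n → Fin k → ZMod 2}
    (h : ∀ v, v ≠ 0 → d ≤ weight c v) : 2 * (d * (2 ^ k - 1)) ≤ 2 ^ k * n := by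
  rw [← sum_weight c]
  refine le_trans ?_ (Nat.le_add_right _ _)
  refine Nat.mul_le_mul_left 2 ?_
  rw [← sum_erase _ (weight_zero c)]
  refine le_trans ?_ (card_nsmul_le_sum _ _ d fun v hv => h v (ne_of_mem_erase hv))
  simp [card_erase_of_mem, mul_comm]

/-- The nonzero messages orthogonal to p number 2^(k-1) - 1 and each has weight at least d, while
copies of p lower their total weight. -/
theorem multiplicity_bound {n k d : ℕ} {c : Fin n → Fin k → ZMod 2} {p : Fin k → ZMod 2}
    (hp : p ≠ 0) (h : ∀ v, v ≠ 0 → d ≤ weight c v) :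
    2 * (d * (2 ^ k - 2)) + 2 ^ k * multiplicity c p ≤ 2 ^ k * n := by
  have h1 := sum_weight_hyperplane c hp
  have h2 : d * (#{v | p ⬝ᵥ v = 0} - 1) ≤ ∑ v with p ⬝ᵥ v = 0, weight c v := by
    rw [← sum_erase _ (weight_zero c)]
    refine le_trans ?_ (card_nsmul_le_sum _ _ d fun v hv => h v (ne_of_mem_erase hv))
    rw [card_erase_of_mem (by simp), smul_eq_mul, mul_comm]
  have h3 : d * (2 ^ k - 2) = 2 * (d * (#{v | p ⬝ᵥ v = 0} - 1)) := by
    rw [← card_hyperplane hp, ← Nat.mul_sub_one]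
    ring
  rw [h3, ← h1, mul_add]
  omega

/-! ### Parity extension and optimality -/

/-- The columns of the code extended by a parity bit. -/
def parityExtension {n k : ℕ} (c : Fin n → Fin k → ZMod 2) : Fin (n + 1) → Fin k → ZMod 2 :=
  Fin.cons (∑ i, c i) c

theorem weight_parityExtension {n k : ℕ} (c : Fin n → Fin k → ZMod 2) (v : Fin k → ZMod 2) :
    weight (parityExtension c) v = (if (∑ i, c i) ⬝ᵥ v ≠ 0 then 1 else 0) + weight c v := by
  rw [weight, Fin.card_filter_univ_succ, weight, parityExtension]
  simp only [Fin.cons_zero, Fin.cons_succ]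
  split_ifs <;> omega

theorem natCast_weight {n k : ℕ} (c : Fin n → Fin k → ZMod 2) (v : Fin k → ZMod 2) :
    (weight c v : ZMod 2) = (∑ i, c i) ⬝ᵥ v := by
  have h : ∀ a : ZMod 2, ((if a ≠ 0 then 1 else 0 : ℕ) : ZMod 2) = a := by decide
  rw [weight, card_filter, Nat.cast_sum, sum_dotProduct]
  exact sum_congr rfl fun i _ => h _

theorem even_weight_parityExtension {n k : ℕ} (c : Fin n → Fin k → ZMod 2) (v : Fin k → ZMod 2) :
    Even (weight (parityExtension c) v) := by
  rw [← ZMod.natCast_eq_zero_iff_even, natCast_weight, parityExtension, Fin.sum_univ_succ]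
  simp only [Fin.cons_zero, Fin.cons_succ]
  rw [ZModModule.add_self, zero_dotProduct]

theorem le_weight_parityExtension {n k d : ℕ} {c : Fin n → Fin k → ZMod 2} (hd : Odd d)
    (h : ∀ v, v ≠ 0 → d ≤ weight c v) (v : Fin k → ZMod 2) (hv : v ≠ 0) :
    d + 1 ≤ weight (parityExtension c) v := by
  have h1 := weight_parityExtension c v
  have h2 := h v hv
  have h3 := even_weight_parityExtension c v
  have h4 : weight (parityExtension c) v ≠ d := by
    rintro h5
    rw [h5] at h3
    exact Nat.not_even_iff_odd.2 hd h3
  omega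

theorem isOptimal_of_bound {n k d : ℕ} {C : BinaryCode n} (h : C.HasParameters k d)
    (hbound : ∀ c : Fin n → Fin k → ZMod 2, (∀ v, v ≠ 0 → d + 1 ≤ weight c v) → False) :
    C.IsOptimal := by
  refine ⟨d, h.2, fun C' hC' d' hd' => ?_⟩
  obtain ⟨c, hc, rfl⟩ := exists_columns C' (hC'.trans h.1)
  by_contra! hlt
  exact hbound c fun v hv => le_trans hlt (((hasMinDist_ofColumns hc).1 hd').1 v hv)

theorem IsOptimal.le_weight {n k d : ℕ} {c : Fin n → Fin k → ZMod 2} (hc : Spanning c)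
    (h : (ofColumns c).IsOptimal) {C : BinaryCode n} (hC : C.HasParameters k d)
    (v : Fin k → ZMod 2) (hv : v ≠ 0) : d ≤ weight c v := by
  obtain ⟨d', hd', hmax⟩ := h
  exact (hmax C (by rw [hC.1, hc.dim_eq]) d hC.2).trans
    (((hasMinDist_ofColumns hc).1 hd').1 v hv)

/-- The vector whose coordinates are the binary digits of `a`. -/
def bits (k a : ℕ) : Fin k → ZMod 2 := fun j => if a.testBit j then 1 else 0

theorem spanning_of_weight {n k d : ℕ} {c : Fin n → Fin k → ZMod 2} (hd : 0 < d)
    (h : ∀ v, v ≠ 0 → d ≤ weight c v) : Spanning c := by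
  intro v hv
  by_contra h0
  have := h v h0
  simp only [weight, hv, ne_eq, not_true_eq_false, filter_false, card_empty] at this
  omega

theorem hasParameters_ofColumns {n k d : ℕ} {c : Fin n → Fin k → ZMod 2} (hd : 0 < d)
    (h : ∀ v, v ≠ 0 → d ≤ weight c v) (h' : ∃ v, v ≠ 0 ∧ weight c v = d) :
    (ofColumns c).HasParameters k d :=
  have hc := spanning_of_weight hd h
  ⟨hc.dim_eq, (hasMinDist_ofColumns hc).2 ⟨h, h'⟩⟩

/-! ### Multiplicities and linear changes of columns -/

theorem sum_multiplicity {n k : ℕ} (c : Fin n → Fin k → ZMod 2) :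
    ∑ p, multiplicity c p = n := by
  have h := card_eq_sum_card_fiberwise (s := univ) (t := univ) (f := c) (by simp)
  rw [card_univ, Fintype.card_fin] at h
  exact h.symm

theorem weight_eq_sum_multiplicity {n k : ℕ} (c : Fin n → Fin k → ZMod 2) (v : Fin k → ZMod 2) :
    weight c v = ∑ p with p ⬝ᵥ v ≠ 0, multiplicity c p := by
  rw [weight, card_eq_sum_card_fiberwise (t := {p | p ⬝ᵥ v ≠ 0}) (f := c)
    fun i hi => by simpa using hi]
  refine sum_congr rfl fun p hp => ?_
  rw [multiplicity, filter_filter]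
  congr 1
  ext i
  simp only [mem_filter, mem_univ, true_and] at hp ⊢
  exact ⟨fun h => h.2, fun h => ⟨h ▸ hp, h⟩⟩

theorem injective_of_multiplicity_le_one {n k : ℕ} {c : Fin n → Fin k → ZMod 2}
    (h : ∀ i, multiplicity c (c i) ≤ 1) : Function.Injective c := by
  intro i j hij
  exact card_le_one.1 (h i) i (by simp) j (by simp [hij])

theorem multiplicity_of_injective {n k : ℕ} {c : Fin n → Fin k → ZMod 2}
    (hc : Function.Injective c) {S : Finset (Fin k → ZMod 2)} (hS : ∀ i, c i ∈ S)
    (hcard : #S = n) (p : Fin k → ZMod 2) : multiplicity c p = if p ∈ S then 1 else 0 := by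
  have himage : univ.image c = S := by
    refine eq_of_subset_of_card_le (fun p hp => ?_) ?_
    · obtain ⟨i, -, rfl⟩ := mem_image.1 hp
      exact hS i
    · rw [card_image_of_injective _ hc, hcard, card_univ, Fintype.card_fin]
  rw [multiplicity]
  split_ifs with hp
  · obtain ⟨i, -, rfl⟩ := mem_image.1 (himage ▸ hp)
    rw [card_eq_one]
    exact ⟨i, by ext j; simp [hc.eq_iff]⟩
  · rw [card_eq_zero, filter_eq_empty_iff]
    rintro i - rfl
    exact hp (hS i)

theorem equivalent_of_injective {n k : ℕ} {c c' : Fin n → Fin k → ZMod 2}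
    (hc : Function.Injective c) (hc' : Function.Injective c') {S : Finset (Fin k → ZMod 2)}
    (hS : ∀ i, c i ∈ S) (hS' : ∀ i, c' i ∈ S) (hcard : #S = n) :
    (ofColumns c).Equivalent (ofColumns c') :=
  equivalent_of_multiplicity_eq fun p => by
    rw [multiplicity_of_injective hc hS hcard, multiplicity_of_injective hc' hS' hcard]

theorem exists_linearEquiv_apply_eq {K V ι : Type*} [Field K] [AddCommGroup V] [Module K V]
    [FiniteDimensional K V] [Finite ι] {u w : ι → V} (hu : LinearIndependent K u)
    (hw : LinearIndependent K w) : ∃ A : V ≃ₗ[K] V, ∀ i, A (u i) = w i := by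
  let bu := Module.Basis.sumExtend hu
  let bw := Module.Basis.sumExtend hw
  have := Fintype.ofFinite ι
  have : Finite (ι ⊕ Module.Basis.sumExtendIndex hu) := Module.Finite.finite_basis bu
  have : Finite (ι ⊕ Module.Basis.sumExtendIndex hw) := Module.Finite.finite_basis bw
  have : Finite (Module.Basis.sumExtendIndex hu) := Finite.sum_right ι
  have : Finite (Module.Basis.sumExtendIndex hw) := Finite.sum_right ι
  have h1 := Module.finrank_eq_nat_card_basis bu
  have h2 := Module.finrank_eq_nat_card_basis bw
  rw [Nat.card_sum] at h1 h2
  have e : Module.Basis.sumExtendIndex hu ≃ Module.Basis.sumExtendIndex hw :=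
    (Finite.card_eq.1 (by omega)).some
  refine ⟨bu.equiv bw (Equiv.sumCongr (Equiv.refl _) e), fun i => ?_⟩
  have hbu : bu (Sum.inl i) = u i := by simp [bu, Module.Basis.sumExtend]; rfl
  have hbw : bw (Sum.inl i) = w i := by simp [bw, Module.Basis.sumExtend]; rfl
  rw [← hbu, Module.Basis.equiv_apply, ← hbw]
  simp

theorem linearIndependent_pair {V : Type*} [AddCommGroup V] [Module (ZMod 2) V] {a b : V}
    (ha : a ≠ 0) (hb : b ≠ 0) (hab : a ≠ b) : LinearIndependent (ZMod 2) ![a, b] := by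
  have hab' : a + b ≠ 0 := fun h => hab (by
    rwa [add_eq_zero_iff_eq_neg, ZModModule.neg_eq_self] at h)
  rw [LinearIndependent.pair_iff]
  intro s t h
  have hdichotomy : ∀ r : ZMod 2, r = 0 ∨ r = 1 := by decide
  rcases hdichotomy s with rfl | rfl <;> rcases hdichotomy t with rfl | rfl <;> simp_all

/-! ### Forced column configurations in lengths 3, 6, 12 and 15 -/

theorem columns_three {c : Fin 3 → Fin 1 → ZMod 2} (hc : ∀ i, c i ≠ 0) :
    c = fun _ => bits 1 1 := by
  have h : ∀ p : Fin 1 → ZMod 2, p ≠ 0 → p = bits 1 1 := by decide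
  exact funext fun i => h _ (hc i)

/-- Each of the three nonzero points occurs at most twice, and six columns need equality. -/
theorem multiplicity_six {c : Fin 6 → Fin 2 → ZMod 2} (hc : ∀ i, c i ≠ 0)
    (hw : ∀ v, v ≠ 0 → 4 ≤ weight c v) (p : Fin 2 → ZMod 2) :
    multiplicity c p = if p = 0 then 0 else 2 := by
  have h0 : multiplicity c 0 = 0 := by simpa [multiplicity, filter_eq_empty_iff] using hc
  split_ifs with hp
  · rw [hp, h0]
  · have h1 := sum_multiplicity c
    have h2 : ∀ p, p ≠ 0 → multiplicity c p ≤ 2 := fun p hp => by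
      have := multiplicity_bound hp hw
      omega
    rw [← add_sum_erase _ _ (mem_univ 0), ← add_sum_erase _ _ (mem_erase.2 ⟨hp, mem_univ p⟩)] at h1
    have h3 : ∑ q ∈ (univ.erase 0).erase p, multiplicity c q ≤ #((univ.erase 0).erase p) • 2 :=
      sum_le_card_nsmul _ _ 2 fun q hq => h2 q (by simp_all)
    have h4 : #((univ.erase (0 : Fin 2 → ZMod 2)).erase p) = 2 := by
      rw [card_erase_of_mem (by simp [hp]), card_erase_of_mem (mem_univ _)]
      rfl
    have h5 := h2 p hp
    rw [h4, smul_eq_mul] at h3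
    omega

theorem equivalent_six {c c' : Fin 6 → Fin 2 → ZMod 2} (hc : ∀ i, c i ≠ 0)
    (hw : ∀ v, v ≠ 0 → 4 ≤ weight c v) (hc' : ∀ i, c' i ≠ 0)
    (hw' : ∀ v, v ≠ 0 → 4 ≤ weight c' v) : (ofColumns c).Equivalent (ofColumns c') :=
  equivalent_of_multiplicity_eq fun p => by
    rw [multiplicity_six hc hw, multiplicity_six hc' hw']

theorem injective_twelve {c : Fin 12 → Fin 4 → ZMod 2} (hc : ∀ i, c i ≠ 0)
    (hw : ∀ v, v ≠ 0 → 6 ≤ weight c v) : Function.Injective c :=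
  injective_of_multiplicity_le_one fun i => by
    have := multiplicity_bound (hc i) hw
    omega

theorem card_compl_image {n k : ℕ} {c : Fin n → Fin k → ZMod 2} (hc : Function.Injective c) :
    #(univ.image c)ᶜ = 2 ^ k - n := by
  rw [card_compl, card_image_of_injective _ hc]
  simp

set_option synthInstance.maxSize 400 in
theorem exists_normal_form_twelve {c : Fin 12 → Fin 4 → ZMod 2} (hc : ∀ i, c i ≠ 0)
    (hw : ∀ v, v ≠ 0 → 6 ≤ weight c v) :
    ∃ A : (Fin 4 → ZMod 2) ≃ₗ[ZMod 2] (Fin 4 → ZMod 2), ∀ i,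
      A (c i) ∈ ({0, bits 4 1, bits 4 2, bits 4 3} : Finset (Fin 4 → ZMod 2))ᶜ := by
  have hinj := injective_twelve hc hw
  obtain ⟨a, ha, b, hb, hab⟩ : ∃ a ∈ (univ.image c)ᶜ.erase 0, ∃ b ∈ (univ.image c)ᶜ.erase 0,
      a ≠ b := by
    rw [← one_lt_card]
    have := pred_card_le_card_erase (s := (univ.image c)ᶜ) (a := 0)
    rw [card_compl_image hinj] at this
    omega
  simp only [mem_erase, mem_compl, mem_image, mem_univ, true_and, not_exists] at ha hb
  obtain ⟨A, hA⟩ := exists_linearEquiv_apply_eq (linearIndependent_pair ha.1 hb.1 hab)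
    (linearIndependent_pair (a := bits 4 1) (b := bits 4 2) (by decide) (by decide) (by decide))
  have hAa : A a = bits 4 1 := hA 0
  have hAb : A b = bits 4 2 := hA 1
  set c' : Fin 12 → Fin 4 → ZMod 2 := fun i => A (c i) with hc'
  have hinj' : Function.Injective c' := A.injective.comp hinj
  have h1 : ∀ i, c' i ≠ bits 4 1 := fun i h => ha.2 i (A.injective (h.trans hAa.symm))
  have h2 : ∀ i, c' i ≠ bits 4 2 := fun i h => hb.2 i (A.injective (h.trans hAb.symm))
  obtain ⟨d, hd, hd'⟩ : ∃ d ∈ (univ.image c')ᶜ,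
      d ∉ ({0, bits 4 1, bits 4 2} : Finset (Fin 4 → ZMod 2)) := by
    refine exists_mem_notMem_of_card_lt_card ?_
    rw [card_compl_image hinj']
    decide
  simp only [mem_compl, mem_image, mem_univ, true_and, not_exists] at hd
  -- Otherwise the three missing points are independent, so some v is 1 on all of them; only 8 - 3 =
  -- 5 points are then left to contribute to the weight of v.
  have key : ∀ d : Fin 4 → ZMod 2, d ∉ ({0, bits 4 1, bits 4 2} : Finset (Fin 4 → ZMod 2)) →
      d ≠ bits 4 3 → ∃ v, v ≠ 0 ∧
        #{p | p ⬝ᵥ v ≠ 0 ∧ p ≠ bits 4 1 ∧ p ≠ bits 4 2 ∧ p ≠ d} ≤ 5 := by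
    decide +kernel
  have hd3 : d = bits 4 3 := by
    by_contra hne
    obtain ⟨v, hv, hcard⟩ := key d hd' hne
    obtain ⟨w, hw0, hvw⟩ := exists_weight_linearEquiv c A hv
    change weight c' v = _ at hvw
    have hle : weight c' v ≤ #{p | p ⬝ᵥ v ≠ 0 ∧ p ≠ bits 4 1 ∧ p ≠ bits 4 2 ∧ p ≠ d} :=
      card_le_card_of_injOn c' (fun i hi => by
        simp only [coe_filter, mem_univ, true_and, Set.mem_ofPred_eq] at hi ⊢
        exact ⟨hi, h1 i, h2 i, hd i⟩) hinj'.injOn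
    have := hw w hw0
    omega
  refine ⟨A, fun i => ?_⟩
  simp only [mem_compl, mem_insert, mem_singleton, not_or]
  exact ⟨by simpa using hc i, h1 i, h2 i, hd3 ▸ hd i⟩

/-- After moving a to the first basis vector, the map T adds a multiple of that vector so as to
exchange the transported functional with the first coordinate. -/
theorem exists_linearEquiv_functional {k : ℕ} {a v : Fin (k + 1) → ZMod 2} (h : a ⬝ᵥ v = 1) :
    ∃ A : (Fin (k + 1) → ZMod 2) ≃ₗ[ZMod 2] (Fin (k + 1) → ZMod 2),
      A a = Pi.single 0 1 ∧ ∀ p, A p 0 = p ⬝ᵥ v := by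
  have hli : ∀ b : Fin (k + 1) → ZMod 2, b ≠ 0 → LinearIndependent (ZMod 2) fun _ : Unit => b :=
    fun b hb => LinearIndependent.of_subsingleton () hb
  have ha : a ≠ 0 := by
    rintro rfl
    simp at h
  obtain ⟨B, hB⟩ := exists_linearEquiv_apply_eq (hli a ha)
    (hli (Pi.single 0 1) (by simp))
  let T : (Fin (k + 1) → ZMod 2) →ₗ[ZMod 2] (Fin (k + 1) → ZMod 2) :=
    { toFun := fun p => p + (B.symm p ⬝ᵥ v + p 0) • Pi.single 0 1
      map_add' := fun p q => by
        rw [map_add, add_dotProduct, Pi.add_apply]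
        module
      map_smul' := fun r p => by
        rw [map_smul, smul_dotProduct, Pi.smul_apply, RingHom.id_apply]
        simp only [smul_eq_mul]
        module }
  have hBs : B.symm (Pi.single 0 1) = a := by rw [← hB (), B.symm_apply_apply]
  have hT : ∀ p, T p = p + (B.symm p ⬝ᵥ v + p 0) • Pi.single 0 1 := fun _ => rfl
  have hT0 : ∀ p, T p 0 = B.symm p ⬝ᵥ v := by
    intro p
    rw [hT]
    simp only [Pi.add_apply, Pi.smul_apply, Pi.single_eq_same, smul_eq_mul, mul_one]
    rw [add_left_comm, CharTwo.add_self_eq_zero, add_zero]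
  have hinv : Function.Involutive T := by
    intro p
    rw [hT (T p), hT0, hT p, map_add, map_smul, hBs, add_dotProduct, smul_dotProduct, h,
      smul_eq_mul, mul_one]
    rw [add_assoc, ← add_smul]
    have : ∀ x y : ZMod 2, x + y + (x + (x + y) + x) = 0 := by decide
    rw [this, zero_smul, add_zero]
  refine ⟨B.trans (LinearEquiv.ofInvolutive T hinv), ?_, fun p => ?_⟩
  · change T (B a) = _
    rw [hB (), hT, hBs, h, Pi.single_eq_same, CharTwo.add_self_eq_zero, zero_smul, add_zero]
  · change T (B p) 0 = _
    rw [hT0, B.symm_apply_apply]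

theorem exists_normal_form_fifteen {c : Fin 15 → Fin 5 → ZMod 2}
    (hw : ∀ v, v ≠ 0 → 7 ≤ weight c v) :
    Function.Injective c ∧ ∃ A : (Fin 5 → ZMod 2) ≃ₗ[ZMod 2] (Fin 5 → ZMod 2), ∀ i,
      A (c i) ∈ ({p | p 0 = 1 ∧ p ≠ Pi.single 0 1} : Finset (Fin 5 → ZMod 2)) := by
  set e := parityExtension c with he
  have he8 : ∀ v, v ≠ 0 → 8 ≤ weight e v := le_weight_parityExtension (by decide) hw
  have hsum := sum_weight e
  have hsum' : ∑ v, weight e v = ∑ v ∈ univ.erase 0, weight e v :=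
    (sum_erase _ (weight_zero e)).symm
  have hcard : #(univ.erase (0 : Fin 5 → ZMod 2)) = 31 := by
    rw [card_erase_of_mem (mem_univ _), card_univ]
    simp
  have hlow : #(univ.erase (0 : Fin 5 → ZMod 2)) • 8 ≤ ∑ v ∈ univ.erase 0, weight e v :=
    card_nsmul_le_sum _ _ 8 fun v hv => he8 v (ne_of_mem_erase hv)
  rw [hcard, smul_eq_mul] at hlow
  -- The total weight is 256 - 16 · `multiplicity e 0`, yet 31 words of weight at least 8 need 248.
  have h0 : multiplicity e 0 = 0 := by omega
  have hne : ∀ i, e i ≠ 0 := by simpa [multiplicity, filter_eq_empty_iff] using h0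
  have hone : ∀ i, multiplicity e (e i) ≤ 1 := fun i => by
    have := multiplicity_bound (hne i) he8
    omega
  have hinj : Function.Injective e := injective_of_multiplicity_le_one hone
  obtain ⟨v, hv, hv8⟩ : ∃ v, v ≠ 0 ∧ weight e v ≠ 8 := by
    by_contra! H
    have : ∑ v ∈ univ.erase 0, weight e v = ∑ v ∈ univ.erase (0 : Fin 5 → ZMod 2), 8 :=
      sum_congr rfl fun v hv => H v (ne_of_mem_erase hv)
    rw [sum_const, hcard, smul_eq_mul] at this
    omega
  -- A column orthogonal to v is impossible: the 15 nonzero words of its hyperplane have total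
  -- weight exactly 120, so all have weight 8, but v is heavier.
  have hdot : ∀ i, e i ⬝ᵥ v = 1 := by
    intro i
    by_contra hi
    have hi0 : e i ⬝ᵥ v = 0 := by
      have : ∀ a : ZMod 2, a ≠ 1 → a = 0 := by decide
      exact this _ hi
    have h1 := sum_weight_hyperplane e (hne i)
    have h2 : 1 ≤ multiplicity e (e i) := card_pos.2 ⟨i, by simp⟩
    have h3 := card_hyperplane (hne i)
    have hv9 : 9 ≤ weight e v := by
      have := he8 v hv
      omega
    have hmem : v ∈ ({v | e i ⬝ᵥ v = 0} : Finset _).erase 0 := by simp [hv, hi0]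
    rw [← sum_erase _ (weight_zero e), ← add_sum_erase _ _ hmem] at h1
    have h4 : #((({v | e i ⬝ᵥ v = 0} : Finset _).erase 0).erase v) • 8 ≤
        ∑ u ∈ (({v | e i ⬝ᵥ v = 0} : Finset _).erase 0).erase v, weight e u :=
      card_nsmul_le_sum _ _ 8 fun u hu => he8 u (by simp_all)
    rw [card_erase_of_mem hmem, card_erase_of_mem (by simp), smul_eq_mul] at h4
    omega
  -- Index 0 is the parity column; fixing its image fixes the point missing from the affine
  -- hyperplane.
  obtain ⟨A, hA, hA0⟩ := exists_linearEquiv_functional (hdot 0)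
  refine ⟨fun i j hij => Fin.succ_injective _ (hinj (by simpa [he, parityExtension] using hij)),
    A, fun i => ?_⟩
  have hi : c i = e i.succ := rfl
  rw [mem_filter, hi, hA0, hdot, ← hA]
  exact ⟨mem_univ _, rfl, fun h => Fin.succ_ne_zero i (hinj (A.injective h))⟩

/-! ### Classification in length 9 -/

theorem multiplicity_linearEquiv {n k : ℕ} (c : Fin n → Fin k → ZMod 2)
    (A : (Fin k → ZMod 2) ≃ₗ[ZMod 2] (Fin k → ZMod 2)) (p : Fin k → ZMod 2) :
    multiplicity (fun i => A (c i)) (A p) = multiplicity c p := by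
  simp [multiplicity]

/-- Columns, as binary numbers, of the eight optimal `3`-CIS codes of length nine. -/
def nineColumns (j : Fin 8) (i : Fin 9) : Fin 3 → ZMod 2 :=
  bits 3 ((![![1, 2, 4, 1, 2, 6, 1, 4, 7], ![1, 2, 4, 1, 2, 7, 1, 4, 7],
    ![1, 2, 4, 1, 2, 6, 1, 5, 7], ![1, 2, 4, 1, 3, 6, 1, 5, 7], ![1, 2, 4, 1, 2, 5, 4, 3, 6],
    ![1, 2, 4, 1, 2, 4, 3, 5, 7], ![1, 2, 4, 1, 4, 7, 2, 3, 7],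
    ![1, 2, 4, 1, 2, 5, 3, 6, 7]] : Fin 8 → Fin 9 → ℕ) j i)

/-- A number that orders lists of multiplicities less than four lexicographically. -/
def lexCode (m₁ m₂ m₄ m₃ m₅ m₆ m₇ : ℕ) : ℕ :=
  4096 * m₁ + 1024 * m₂ + 256 * m₄ + 64 * m₃ + 16 * m₅ + 4 * m₆ + m₇

/-- `mₐ` are possible multiplicities of the columns `bits 3 a` of a `[9, 3, 4]` code without zero
coordinates. -/
def Admissible (m₁ m₂ m₄ m₃ m₅ m₆ m₇ : ℕ) : Prop :=
  m₁ + m₂ + m₃ + m₄ + m₅ + m₆ + m₇ = 9 ∧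
    4 ≤ m₁ + m₃ + m₅ + m₇ ∧ 4 ≤ m₂ + m₃ + m₆ + m₇ ∧ 4 ≤ m₄ + m₅ + m₆ + m₇ ∧
    4 ≤ m₁ + m₂ + m₅ + m₆ ∧ 4 ≤ m₁ + m₄ + m₃ + m₆ ∧ 4 ≤ m₂ + m₄ + m₃ + m₅ ∧
    4 ≤ m₁ + m₂ + m₄ + m₇

instance (m₁ m₂ m₄ m₃ m₅ m₆ m₇ : ℕ) : Decidable (Admissible m₁ m₂ m₄ m₃ m₅ m₆ m₇) := by
  unfold Admissible
  infer_instance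

/-- The multiplicities `mₐ` are lexicographically at least as large as their images under six linear
maps. -/
def LexMaximal (m₁ m₂ m₄ m₃ m₅ m₆ m₇ : ℕ) : Prop :=
  lexCode m₃ m₆ m₁ m₅ m₂ m₇ m₄ ≤ lexCode m₁ m₂ m₄ m₃ m₅ m₆ m₇ ∧
  lexCode m₁ m₄ m₇ m₅ m₆ m₃ m₂ ≤ lexCode m₁ m₂ m₄ m₃ m₅ m₆ m₇ ∧
  lexCode m₂ m₁ m₅ m₃ m₇ m₄ m₆ ≤ lexCode m₁ m₂ m₄ m₃ m₅ m₆ m₇ ∧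
  lexCode m₁ m₂ m₆ m₃ m₇ m₄ m₅ ≤ lexCode m₁ m₂ m₄ m₃ m₅ m₆ m₇ ∧
  lexCode m₁ m₇ m₅ m₆ m₄ m₂ m₃ ≤ lexCode m₁ m₂ m₄ m₃ m₅ m₆ m₇ ∧
  lexCode m₂ m₄ m₁ m₆ m₃ m₅ m₇ ≤ lexCode m₁ m₂ m₄ m₃ m₅ m₆ m₇

instance (m₁ m₂ m₄ m₃ m₅ m₆ m₇ : ℕ) : Decidable (LexMaximal m₁ m₂ m₄ m₃ m₅ m₆ m₇) := by
  unfold LexMaximal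
  infer_instance

set_option synthInstance.maxSize 1000 in
theorem Admissible.exists_nineColumns : ∀ m₁ m₂ m₄ m₃ m₅ m₆ m₇ : Fin 4,
    Admissible m₁ m₂ m₄ m₃ m₅ m₆ m₇ → LexMaximal m₁ m₂ m₄ m₃ m₅ m₆ m₇ →
    ∃ j : Fin 8, m₁ = multiplicity (nineColumns j) (bits 3 1) ∧
      m₂ = multiplicity (nineColumns j) (bits 3 2) ∧
      m₄ = multiplicity (nineColumns j) (bits 3 4) ∧
      m₃ = multiplicity (nineColumns j) (bits 3 3) ∧
      m₅ = multiplicity (nineColumns j) (bits 3 5) ∧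
      m₆ = multiplicity (nineColumns j) (bits 3 6) ∧
      m₇ = multiplicity (nineColumns j) (bits 3 7) := by
  decide +kernel

theorem four_le_weight_nineColumns (j : Fin 8) :
    ∀ v, v ≠ 0 → 4 ≤ weight (nineColumns j) v := by
  revert j
  decide +kernel

theorem hasParameters_nineColumns (j : Fin 8) :
    (ofColumns (nineColumns j)).HasParameters 3 4 := by
  refine hasParameters_ofColumns (by decide) (four_le_weight_nineColumns j) ?_
  revert j
  decide +kernel

theorem isCIS_nineColumns (j : Fin 8) : (ofColumns (nineColumns j)).IsCIS 3 := by
  refine isCIS_ofColumns (t := 3) (k := 3)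
    (spanning_of_weight (by decide) (four_le_weight_nineColumns j)) ?_
  revert j
  decide +kernel

/-- The Plotkin bound allows distance 5 in length 9, but the parity bit would turn it into distance
6 in length 10, where 84 > 80. -/
theorem isOptimal_of_hasParameters_nine {C : BinaryCode 9} (h : C.HasParameters 3 4) :
    C.IsOptimal :=
  isOptimal_of_bound h fun _ hc => by
    have := plotkin_bound (le_weight_parityExtension (by decide) hc)
    omega

set_option synthInstance.maxSize 1000 in
theorem nineColumns_injective {i j : Fin 8}
    (h : (ofColumns (nineColumns i)).Equivalent (ofColumns (nineColumns j))) : i = j := by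
  have h1 := h.ncard_hammingNorm_eq 4
  have h2 := h.ncard_unrepeated_eq
  have hs := fun j => spanning_of_weight (by decide) (four_le_weight_nineColumns j)
  rw [(hs i).ncard_hammingNorm_eq, (hs j).ncard_hammingNorm_eq] at h1
  rw [ncard_unrepeated_ofColumns, ncard_unrepeated_ofColumns] at h2
  have key : ∀ i j : Fin 8, #{v | weight (nineColumns i) v = 4} =
      #{v | weight (nineColumns j) v = 4} →
      #{a | ∀ b, nineColumns i b = nineColumns i a → b = a} =
        #{a | ∀ b, nineColumns j b = nineColumns j a → b = a} → i = j := by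
    decide +kernel
  exact key i j h1 h2

theorem bits_three_bijective : Function.Bijective fun a : Fin 8 => bits 3 a := by
  decide +kernel

theorem exists_normal_form_nine {c : Fin 9 → Fin 3 → ZMod 2} (hc : ∀ i, c i ≠ 0)
    (hw : ∀ v, v ≠ 0 → 4 ≤ weight c v) :
    ∃ A : (Fin 3 → ZMod 2) ≃ₗ[ZMod 2] (Fin 3 → ZMod 2), ∃ j, ∀ p,
      multiplicity (nineColumns j) p = multiplicity (fun i => A (c i)) p := by
  let f : ((Fin 3 → ZMod 2) ≃ₗ[ZMod 2] (Fin 3 → ZMod 2)) → ℕ → ℕ := fun A a =>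
    multiplicity (fun i => A (c i)) (bits 3 a)
  have : Finite ((Fin 3 → ZMod 2) ≃ₗ[ZMod 2] (Fin 3 → ZMod 2)) := DFunLike.finite _
  -- Maximising over the whole group makes the six comparisons of `LexMaximal` available at once.
  obtain ⟨A, hA⟩ := Finite.exists_max fun A =>
    lexCode (f A 1) (f A 2) (f A 4) (f A 3) (f A 5) (f A 6) (f A 7)
  set m := f A with hm
  have hne : ∀ i, A (c i) ≠ 0 := fun i => by simpa using hc i
  have hw' : ∀ v, v ≠ 0 → 4 ≤ weight (fun i => A (c i)) v := fun v hv => by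
    obtain ⟨w, hw0, hvw⟩ := exists_weight_linearEquiv c A hv
    rw [hvw]
    exact hw w hw0
  have h0 : m 0 = 0 := by
    have : bits 3 0 = 0 := by decide
    simp only [hm, f, this, multiplicity, card_eq_zero, filter_eq_empty_iff]
    exact fun i _ => hne i
  have hlt : ∀ a, bits 3 a ≠ 0 → m a < 4 := fun a ha => by
    have := multiplicity_bound ha hw'
    simp only [hm, f]
    omega
  have hsum : ∑ a : Fin 8, m a = 9 := by
    rw [← sum_multiplicity fun i => A (c i)]
    exact Fintype.sum_bijective _ bits_three_bijective _ _ fun _ => rfl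
  have hweight : ∀ v, bits 3 v ≠ 0 →
      4 ≤ ∑ a : Fin 8, if bits 3 a ⬝ᵥ bits 3 v ≠ 0 then m a else 0 := by
    intro v hv
    refine (hw' _ hv).trans_eq ?_
    rw [weight_eq_sum_multiplicity, sum_filter]
    exact (Fintype.sum_bijective _ bits_three_bijective _ _ fun _ => rfl).symm
  -- Precomposing the lookup of multiplicities with M amounts to replacing A by A followed by the
  -- inverse of M, which cannot beat the maximum.
  have hlex : ∀ (M : Matrix (Fin 3) (Fin 3) (ZMod 2)) (g : Fin 8 → ℕ),
      (∀ v w, M *ᵥ v = M *ᵥ w → v = w) → (∀ a : Fin 8, M *ᵥ bits 3 a = bits 3 (g a)) →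
      lexCode (m (g 1)) (m (g 2)) (m (g 4)) (m (g 3)) (m (g 5)) (m (g 6)) (m (g 7)) ≤
        lexCode (m 1) (m 2) (m 4) (m 3) (m 5) (m 6) (m 7) := by
    intro M g hM hg
    let B := LinearEquiv.ofInjectiveEndo (Matrix.mulVecLin M) fun v w => hM v w
    have hB : ∀ a : Fin 8, m (g a) = f (A.trans B.symm) a := by
      intro a
      have hBa : bits 3 (g a) = B (bits 3 a) := (hg a).symm
      simp only [hm, f]
      rw [hBa, ← multiplicity_linearEquiv _ B.symm, B.symm_apply_apply]
      rfl
    simp only [hB]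
    exact hA (A.trans B.symm)
  have h1 := hlex (Matrix.of fun i j => bits 3 ((![3, 6, 1] : Fin 3 → ℕ) j) i)
    ![0, 3, 6, 5, 1, 2, 7, 4] (by decide +kernel) (by decide +kernel)
  have h2 := hlex (Matrix.of fun i j => bits 3 ((![1, 4, 7] : Fin 3 → ℕ) j) i)
    ![0, 1, 4, 5, 7, 6, 3, 2] (by decide +kernel) (by decide +kernel)
  have h3 := hlex (Matrix.of fun i j => bits 3 ((![2, 1, 5] : Fin 3 → ℕ) j) i)
    ![0, 2, 1, 3, 5, 7, 4, 6] (by decide +kernel) (by decide +kernel)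
  have h4 := hlex (Matrix.of fun i j => bits 3 ((![1, 2, 6] : Fin 3 → ℕ) j) i)
    ![0, 1, 2, 3, 6, 7, 4, 5] (by decide +kernel) (by decide +kernel)
  have h5 := hlex (Matrix.of fun i j => bits 3 ((![1, 7, 5] : Fin 3 → ℕ) j) i)
    ![0, 1, 7, 6, 5, 4, 2, 3] (by decide +kernel) (by decide +kernel)
  have h6 := hlex (Matrix.of fun i j => bits 3 ((![2, 4, 1] : Fin 3 → ℕ) j) i)
    ![0, 2, 4, 6, 1, 3, 5, 7] (by decide +kernel) (by decide +kernel)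
  have hadm : Admissible (m 1) (m 2) (m 4) (m 3) (m 5) (m 6) (m 7) := by
    refine ⟨?_, ?_, ?_, ?_, ?_, ?_, ?_, ?_⟩
    · simp [Fin.sum_univ_eight, h0] at hsum
      omega
    · have := hweight 1 (by decide)
      simp +decide [Fin.sum_univ_eight] at this
      omega
    · have := hweight 2 (by decide)
      simp +decide [Fin.sum_univ_eight] at this
      omega
    · have := hweight 4 (by decide)
      simp +decide [Fin.sum_univ_eight] at this
      omega
    · have := hweight 3 (by decide)
      simp +decide [Fin.sum_univ_eight] at this
      omega
    · have := hweight 5 (by decide)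
      simp +decide [Fin.sum_univ_eight] at this
      omega
    · have := hweight 6 (by decide)
      simp +decide [Fin.sum_univ_eight] at this
      omega
    · have := hweight 7 (by decide)
      simp +decide [Fin.sum_univ_eight] at this
      omega
  obtain ⟨j, e1, e2, e4, e3, e5, e6, e7⟩ := Admissible.exists_nineColumns
    ⟨m 1, hlt 1 (by decide)⟩ ⟨m 2, hlt 2 (by decide)⟩ ⟨m 4, hlt 4 (by decide)⟩
    ⟨m 3, hlt 3 (by decide)⟩ ⟨m 5, hlt 5 (by decide)⟩ ⟨m 6, hlt 6 (by decide)⟩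
    ⟨m 7, hlt 7 (by decide)⟩
    hadm ⟨h1, h2, h3, h4, h5, h6⟩
  have e0 : ∀ j : Fin 8, multiplicity (nineColumns j) (bits 3 0) = 0 := by decide
  refine ⟨A, j, fun p => ?_⟩
  obtain ⟨a, rfl⟩ := bits_three_bijective.2 p
  fin_cases a
  exacts [(e0 j).trans h0.symm, e1.symm, e2.symm, e3.symm, e4.symm, e5.symm, e6.symm, e7.symm]

/-! ### Explicit codes and the final counts -/

/-- The columns, as binary numbers, of the optimal `3`-CIS code of length twelve. -/
def twelveColumns (i : Fin 12) : Fin 4 → ZMod 2 :=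
  bits 4 ((![4, 5, 6, 8, 7, 9, 10, 12, 11, 13, 14, 15] : Fin 12 → ℕ) i)

/-- The columns, as binary numbers, of the optimal `3`-CIS code of length fifteen. -/
def fifteenColumns (i : Fin 15) : Fin 5 → ZMod 2 :=
  bits 5 ((![3, 5, 7, 9, 17, 11, 13, 19, 23, 25, 15, 21, 27, 29, 31] : Fin 15 → ℕ) i)

/-- The columns, as binary numbers, of the optimal `3`-CIS code of length six. -/
def sixColumns (i : Fin 6) : Fin 2 → ZMod 2 :=
  bits 2 ((![1, 2, 1, 3, 2, 3] : Fin 6 → ℕ) i)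

/-- The model `c₀` both attains d and, through `IsOptimal.le_weight`, imposes d on every other
optimal code. -/
theorem numClasses_optimal_eq_one {k d : ℕ} (hd : 0 < d)
    (c₀ : Fin (3 * k) → Fin k → ZMod 2) (hw : ∀ v, v ≠ 0 → d ≤ weight c₀ v)
    (hw' : ∃ v, v ≠ 0 ∧ weight c₀ v = d)
    (hcis : ∀ i : Fin 3, ∀ v, (∀ j, c₀ (finProdFinEquiv (i, j)) ⬝ᵥ v = 0) → v = 0)
    (hbound : ∀ c : Fin (3 * k) → Fin k → ZMod 2, (∀ v, v ≠ 0 → d + 1 ≤ weight c v) → False)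
    (hunique : ∀ c : Fin (3 * k) → Fin k → ZMod 2, (∀ i, c i ≠ 0) →
      (∀ v, v ≠ 0 → d ≤ weight c v) → (ofColumns c₀).Equivalent (ofColumns c)) :
    numClasses {C : BinaryCode (3 * k) | C.IsCIS 3 ∧ C.IsOptimal} = 1 := by
  have hp := hasParameters_ofColumns hd hw hw'
  refine numClasses_eq (fun _ : Fin 1 => ofColumns c₀) (fun _ => ?_) ?_
    fun _ _ _ => Subsingleton.elim _ _
  · exact ⟨isCIS_ofColumns (spanning_of_weight hd hw) hcis, isOptimal_of_bound hp hbound⟩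
  · rintro C ⟨hC, hopt⟩
    obtain ⟨c, hc, rfl⟩ := exists_columns C (k := k) (by have := hC.1; omega)
    exact ⟨0, hunique c hC.column_ne_zero fun v => hopt.le_weight hc hp v⟩

theorem numClasses_three : numClasses {C : BinaryCode 3 | C.IsCIS 3 ∧ C.IsOptimal} = 1 := by
  refine numClasses_optimal_eq_one (k := 1) (d := 3) (by decide) (fun _ => bits 1 1)
    (by decide) (by decide) (by decide) (fun c hc => ?_) fun c hc _ => ?_
  · have := plotkin_bound hc
    omega
  · rw [columns_three hc]
    exact (equivalent_equivalence 3).refl _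

theorem numClasses_six : numClasses {C : BinaryCode 6 | C.IsCIS 3 ∧ C.IsOptimal} = 1 := by
  have hw : ∀ v, v ≠ 0 → 4 ≤ weight sixColumns v := by decide +kernel
  refine numClasses_optimal_eq_one (k := 2) (d := 4) (by decide) sixColumns
    hw (by decide +kernel) (by decide +kernel) (fun c hc => ?_)
    fun c hc hcw => equivalent_six (by decide +kernel) hw hc hcw
  have := plotkin_bound hc
  omega

theorem numClasses_twelve : numClasses {C : BinaryCode 12 | C.IsCIS 3 ∧ C.IsOptimal} = 1 := by
  have hw : ∀ v, v ≠ 0 → 6 ≤ weight twelveColumns v := by decide +kernel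
  refine numClasses_optimal_eq_one (k := 4) (d := 6) (by decide) twelveColumns
    hw (by decide +kernel) (by decide +kernel) (fun c hc => ?_) fun c hc hcw => ?_
  · have := plotkin_bound hc
    omega
  · obtain ⟨A, hA⟩ := exists_normal_form_twelve hc hcw
    rw [← ofColumns_linearEquiv c A]
    exact equivalent_of_injective (by decide +kernel)
      (A.injective.comp (injective_twelve hc hcw)) (by decide +kernel) hA (by decide +kernel)

theorem numClasses_fifteen : numClasses {C : BinaryCode 15 | C.IsCIS 3 ∧ C.IsOptimal} = 1 := by
  refine numClasses_optimal_eq_one (k := 5) (d := 7) (by decide) fifteenColumns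
    (by decide +kernel) (by decide +kernel) (by decide +kernel) (fun c hc => ?_) fun c _ hcw => ?_
  · have := plotkin_bound hc
    omega
  · obtain ⟨hinj, A, hA⟩ := exists_normal_form_fifteen hcw
    rw [← ofColumns_linearEquiv c A]
    exact equivalent_of_injective (by decide +kernel) (A.injective.comp hinj) (by decide +kernel)
      hA (by decide +kernel)

theorem numClasses_nine :
    numClasses {C : BinaryCode 9 | C.IsCIS 3 ∧ C.IsOptimal ∧ C.HasParameters 3 4} = 8 := by
  refine numClasses_eq (fun j => ofColumns (nineColumns j)) (fun j => ?_) ?_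
    fun _ _ => nineColumns_injective
  · have hp := hasParameters_nineColumns j
    exact ⟨isCIS_nineColumns j, isOptimal_of_hasParameters_nine hp, hp⟩
  · rintro C ⟨hC, -, hdim, hdist⟩
    obtain ⟨c, hc, rfl⟩ := exists_columns C hdim
    obtain ⟨A, j, hj⟩ := exists_normal_form_nine hC.column_ne_zero
      ((hasMinDist_ofColumns hc).1 hdist).1
    refine ⟨j, ?_⟩
    rw [← ofColumns_linearEquiv c A]
    exact equivalent_of_multiplicity_eq hj

end BinaryCode

theorem mainTheorem11 :
    (∀ n ∈ ({3, 6, 12, 15} : Set ℕ),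
      BinaryCode.numClasses {C : BinaryCode n | C.IsCIS 3 ∧ C.IsOptimal} = 1) ∧
    BinaryCode.numClasses
      {C : BinaryCode 9 | C.IsCIS 3 ∧ C.IsOptimal ∧ C.HasParameters 3 4} = 8 := by
  refine ⟨?_, BinaryCode.numClasses_nine⟩
  rintro n (rfl | rfl | rfl | rfl)
  exacts [BinaryCode.numClasses_three, BinaryCode.numClasses_six, BinaryCode.numClasses_twelve,
    BinaryCode.numClasses_fifteen]
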